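/- Let $\mathcal A$ be a finite nonempty set with the discrete topology, give $\mathcal A^{\mathbb Z}$ the product topology and its Borel $\sigma$-algebra, and let $\sigma:\mathcal A^{\mathbb Z}\to\mathcal A^{\mathbb Z}$ be the shift, $\sigma(\mathbf a)_z=a_{z-1}$. Suppose that $\mathcal A^{\mathbb Z}$ is a group shift, that is, $\mathcal A^{\mathbb Z}$ carries a group structure (not necessarily componentwise) which makes it a topological group and for which $\sigma$ is a group automorphism. Let $\Phi:\mathcal A^{\mathbb Z}\to\mathcal A^{\mathbb Z}$ be an endomorphic cellular automaton, that is, a continuous map which commutes with $\sigma$ and is a group endomorphism of $\mathcal A^{\mathbb Z}$. Suppose that $\Phi$ is bipermutative: for some integers $\ell,r\ge 0$ there is a local rule $\phi:\mathcal A^{[-\ell\ldots r]}\to\mathcal A$ such that $\Phi(\mathbf a)_z=\phi(a_{z-\ell},\ldots,a_{z+r})$ for all $\mathbf a\in\mathcal A^{\mathbb Z}$ and $z\in\mathbb Z$, and such that $\phi$ is a bijection of $\mathcal A$ as a function of its first variable for any fixed values of the others, and also as a function of its last variable for any fixed values of the others. Suppose further that $\ker(\Phi)$ contains no nontrivial $\sigma$-invariant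 subgroups: every subgroup $\mathcal J\subseteq\ker(\Phi)$ with $\sigma(\mathcal J)=\mathcal J$ is either the trivial group or all of $\ker(\Phi)$. Let $\mu$ be a Borel probability measure on $\mathcal A^{\mathbb Z}$ which is $\Phi$-invariant and totally $\sigma$-ergodic (that is, $\mu$ is invariant and ergodic for $\sigma^n$, for every $n\ge 1$). If the measure-theoretic (Kolmogorov--Sinai) entropy satisfies $h_\mu(\Phi)>0$, then $\mu$ is the uniform Bernoulli measure $\lambda$ on $\mathcal A^{\mathbb Z}$, that is, the measure with $\lambda\{\mathbf a : a_{z_1}=c_1,\ldots,a_{z_M}=c_M\}=|\mathcal A|^{-M}$ for all distinct $z_1,\ldots,z_M\in\mathbb Z$ and all $c_1,\ldots,c_M\in\mathcal A$. -/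

import Mathlib

namespace BipermutativeCA

open MeasureTheory Filter

noncomputable section

/-! ### Shift, cellular automata, group shifts -/

/-- The shift map `σ` on bi-infinite sequences: `σ(a)_z = a_{z-1}`. -/
def shift {A : Type*} (a : ℤ → A) : ℤ → A := fun z => a (z - 1)

/-- A cellular automaton: a continuous self-map of `A^ℤ` commuting with the shift. -/
structure IsCellularAutomaton {A : Type*} [TopologicalSpace A]
    (Φ : (ℤ → A) → (ℤ → A)) : Prop where
  continuous : Continuous Φ
  comm_shift : ∀ a, Φ (shift a) = shift (Φ a)

/-- `Φ` is given by the local rule `φ : A^{[-ℓ...r]} → A`. The position `j ∈ [-ℓ...r]` of the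
window is represented by the index `i = j + ℓ` in `Fin (ℓ + r + 1)`. -/
def HasLocalRule {A : Type*} (Φ : (ℤ → A) → (ℤ → A)) (ℓ r : ℕ)
    (φ : (Fin (ℓ + r + 1) → A) → A) : Prop :=
  ∀ (a : ℤ → A) (z : ℤ), Φ a z = φ (fun i => a (z - (ℓ : ℤ) + ((i : ℕ) : ℤ)))

/-- Right-permutativity: a bijection in the last variable, the others being fixed. -/
def RightPermutative {A : Type*} {n : ℕ} (φ : (Fin (n + 1) → A) → A) : Prop :=
  ∀ a : Fin (n + 1) → A, Function.Bijective fun b : A => φ (Function.update a (Fin.last n) b)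

/-- Left-permutativity: a bijection in the first variable, the others being fixed. -/
def LeftPermutative {A : Type*} {n : ℕ} (φ : (Fin (n + 1) → A) → A) : Prop :=
  ∀ a : Fin (n + 1) → A, Function.Bijective fun b : A => φ (Function.update a 0 b)

/-- `Φ` is bipermutative: it has a local rule, on some window `[-ℓ...r]` with `ℓ, r ≥ 0`, which is
both left- and right-permutative. -/
def IsBipermutative {A : Type*} (Φ : (ℤ → A) → (ℤ → A)) : Prop :=
  ∃ (ℓ r : ℕ) (φ : (Fin (ℓ + r + 1) → A) → A),
    HasLocalRule Φ ℓ r φ ∧ LeftPermutative φ ∧ RightPermutative φ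

/-- `A^ℤ`, with the given group structure (not necessarily componentwise), is a group shift:
it is a topological group for the product topology, and the shift (always a bijection) is a
group automorphism. -/
structure IsGroupShift (A : Type*) [TopologicalSpace A] [Group (ℤ → A)] : Prop where
  isTopologicalGroup : IsTopologicalGroup (ℤ → A)
  shift_mul : ∀ a b : ℤ → A, shift (a * b) = shift a * shift b

/-! ### Measures -/

/-- `μ` is totally `σ`-ergodic: `μ` is invariant and ergodic for every power `σ^n`, `n ≥ 1`. -/
def TotallyShiftErgodic {A : Type*} [MeasurableSpace A] (μ : Measure (ℤ → A)) : Prop :=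
  ∀ n : ℕ, 1 ≤ n → Ergodic (shift^[n]) μ

/-- The uniform Bernoulli measure on `A^ℤ`: the product over `ℤ` of the uniform probability
measure on the finite set `A`. -/
def uniformBernoulli (A : Type*) [Finite A] [Nonempty A] [MeasurableSpace A]
    [MeasurableSingletonClass A] : Measure (ℤ → A) :=
  Measure.infinitePi fun _ : ℤ => ProbabilityTheory.uniformOn (Set.univ : Set A)

/-! ### Entropy of a measure-preserving system (in bits) -/

/-- Shannon entropy of the finite partition of `X` into the fibres of `ξ : X → ι`. -/
def partitionEntropy {X ι : Type*} [MeasurableSpace X] [Fintype ι] (μ : Measure X)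
    (ξ : X → ι) : ℝ :=
  ∑ i, -(μ.real (ξ ⁻¹' {i}) * Real.logb 2 (μ.real (ξ ⁻¹' {i})))

/-- The join `ξ ∨ T⁻¹ξ ∨ ⋯ ∨ T^{-(n-1)}ξ`, as the partition into fibres of the itinerary map. -/
def itinerary {X ι : Type*} (T : X → X) (ξ : X → ι) (n : ℕ) : X → (Fin n → ι) :=
  fun x t => ξ (T^[t] x)

/-- The entropy of `T` relative to `ξ`: `lim (1/n) H(ξ ∨ T⁻¹ξ ∨ ⋯ ∨ T^{-(n-1)}ξ)`. The limit exists
whenever `T` preserves the probability measure `μ`; it is written as an upper limit. -/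
def entropyOfPartition {X ι : Type*} [MeasurableSpace X] [Fintype ι] (μ : Measure X)
    (T : X → X) (ξ : X → ι) : ENNReal :=
  limsup (fun n : ℕ => ENNReal.ofReal (partitionEntropy μ (itinerary T ξ n) / n)) atTop

/-- The Kolmogorov–Sinai entropy `h_μ(T)`: the supremum over all finite measurable partitions. -/
def entropy {X : Type*} [MeasurableSpace X] (μ : Measure X) (T : X → X) : ENNReal :=
  ⨆ (k : ℕ) (ξ : X → Fin k) (_ : Measurable ξ), entropyOfPartition μ T ξ

end

end BipermutativeCA

namespace BipermutativeCA

open MeasureTheory Filter Topology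

noncomputable section

/-! ### Shannon entropy of finite partitions -/

section Entropy

variable {X ι κ : Type*} [MeasurableSpace X]

/-! Let `K` be the kernel of `Φ`. By bipermutativity a point is determined by its image and any one
of its blocks of length `ℓ + r`, and both may be prescribed freely, so `K` is finite, with `|A| ^ (ℓ
+ r)` elements.

Compare `μ` with the sum `ν` of its right translates by `K`. The density `f` of `μ` with respect to
`ν` is shift-invariant, and some power of the shift fixes `K` pointwise, so total ergodicity makes
each function `a ↦ f (a * k)` a constant `c k`. The `k` with `c k ≠ 0` form a shift-invariant
subgroup of `K` (`exists_invariant_subgroup_of_totally_ergodic`), which by hypothesis is trivial or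
all of `K`.

If it is trivial, a set of full measure meets each coset of `K` at most once, so `Φ` is injective
there. A central block is then nearly a function of finitely many coordinates of the image, the
entropy of blocks grows sublinearly, and `Φ` has entropy zero (`entropy_eq_zero_of_injOn`), contrary
to assumption.

If it is `K`, then `μ` is invariant under translation by `K`. A block of length `ℓ + r` is then
uniform and independent of the image (`measure_block_inter_preimage`), and induction through `Φ`
makes all blocks of length `j * (ℓ + r)` uniform (`measure_block_eq`). -/

theorem partitionEntropy_comp [Fintype ι] {μ : Measure X} {T : X → X} (hT : MeasurePreserving T μ μ)
    {f : X → ι} (hf : ∀ i, MeasurableSet (f ⁻¹' {i})) :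
    partitionEntropy μ (fun x => f (T x)) = partitionEntropy μ f := by
  unfold partitionEntropy
  refine Finset.sum_congr rfl fun i _ => ?_
  have : μ.real ((fun x => f (T x)) ⁻¹' {i}) = μ.real (f ⁻¹' {i}) := by
    rw [measureReal_def, measureReal_def, ← hT.measure_preimage (hf i).nullMeasurableSet]
    rfl
  rw [this]

/-- Measurability of partitions is expressed through fibres, so that label types such as `Fin n → A`
need no σ-algebra. -/
theorem measurableSet_preimage_of_factors [Finite ι] {f : X → ι} {g : X → κ}
    (hf : ∀ i, MeasurableSet (f ⁻¹' {i})) (h : ∀ a b, f a = f b → g a = g b) (j : κ) :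
    MeasurableSet (g ⁻¹' {j}) := by
  have : g ⁻¹' {j} = ⋃ i ∈ {i | ∃ a, f a = i ∧ g a = j}, f ⁻¹' {i} := by
    ext x
    simp only [Set.mem_preimage, Set.mem_singleton_iff, Set.mem_iUnion, Set.mem_ofPred_eq,
      exists_prop]
    constructor
    · intro hx
      exact ⟨f x, ⟨x, rfl, hx⟩, rfl⟩
    · rintro ⟨i, ⟨a, rfl, ha⟩, hx⟩
      rw [h x a hx, ha]
  rw [this]
  exact MeasurableSet.biUnion (Set.to_countable _) fun i _ => hf i

/-- Each cell of `g` is a union of cells of `f`, and the logarithm is monotone. -/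
theorem partitionEntropy_le_of_factors [Fintype ι] [Fintype κ] {μ : Measure X}
    [IsProbabilityMeasure μ]
    {f : X → ι} {g : X → κ} (hf : ∀ i, MeasurableSet (f ⁻¹' {i}))
    (h : ∀ a b, f a = f b → g a = g b) : partitionEntropy μ g ≤ partitionEntropy μ f := by
  classical
  obtain ⟨x₀⟩ : Nonempty X := nonempty_of_isProbabilityMeasure μ
  have : Nonempty κ := ⟨g x₀⟩
  obtain ⟨F, rfl⟩ := (Function.factorsThrough_iff (f := f) g).1 fun a b hab => h a b hab
  have hp : ∀ j, μ.real ((F ∘ f) ⁻¹' {j}) =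
      ∑ i ∈ Finset.univ.filter (fun i => F i = j), μ.real (f ⁻¹' {i}) := by
    intro j
    rw [sum_measureReal_preimage_singleton _ fun i _ => hf i]
    congr 1
    ext x
    simp
  unfold partitionEntropy
  rw [← Finset.sum_fiberwise Finset.univ F]
  refine Finset.sum_le_sum fun j _ => ?_
  conv_lhs => rw [hp j, Finset.sum_mul, ← Finset.sum_neg_distrib]
  rw [← hp j]
  refine Finset.sum_le_sum fun i hi => ?_
  simp only [Finset.mem_filter, Finset.mem_univ, true_and] at hi
  rcases (measureReal_nonneg (μ := μ) (s := f ⁻¹' {i})).eq_or_lt with h0 | h0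
  · rw [← h0]; simp
  · have hle : μ.real (f ⁻¹' {i}) ≤ μ.real ((F ∘ f) ⁻¹' {j}) := by
      refine measureReal_mono fun x hx => ?_
      simp only [Set.mem_preimage, Set.mem_singleton_iff, Function.comp] at hx ⊢
      rw [hx, hi]
    have := Real.logb_le_logb_of_le (b := 2) (by norm_num) h0 hle
    nlinarith

theorem partitionEntropy_prod_le [Fintype ι] [Fintype κ] {μ : Measure X} [IsProbabilityMeasure μ]
    {f : X → ι} {g : X → κ} (hf : ∀ i, MeasurableSet (f ⁻¹' {i}))
    (hg : ∀ j, MeasurableSet (g ⁻¹' {j})) :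
    partitionEntropy μ (fun x => (f x, g x)) ≤ partitionEntropy μ f + partitionEntropy μ g := by
  classical
  set P : X → ι × κ := fun x => (f x, g x) with hP
  have hPm : ∀ ij, MeasurableSet (P ⁻¹' {ij}) := by
    rintro ⟨i, j⟩
    have : P ⁻¹' {(i, j)} = f ⁻¹' {i} ∩ g ⁻¹' {j} := by
      ext x; simp [hP]
    rw [this]
    exact (hf i).inter (hg j)
  set p : ι × κ → ℝ := fun ij => μ.real (P ⁻¹' {ij}) with hp
  set u : ι → ℝ := fun i => μ.real (f ⁻¹' {i}) with hu
  set v : κ → ℝ := fun j => μ.real (g ⁻¹' {j}) with hv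
  have hsum : ∀ s : Finset (ι × κ), ∑ ij ∈ s, p ij = μ.real (P ⁻¹' s) := fun s =>
    sum_measureReal_preimage_singleton _ fun i _ => hPm i
  have hu' : ∀ i, u i = ∑ j, p (i, j) := by
    intro i
    have := hsum ({i} ×ˢ Finset.univ)
    rw [Finset.sum_product, Finset.sum_singleton] at this
    rw [this]
    exact congrArg μ.real (by ext x; simp [hP, eq_comm])
  have hv' : ∀ j, v j = ∑ i, p (i, j) := by
    intro j
    have := hsum (Finset.univ ×ˢ {j})
    rw [Finset.sum_product] at this
    simp only [Finset.sum_singleton] at this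
    rw [this]
    exact congrArg μ.real (by ext x; simp [hP, eq_comm])
  have hp1 : ∑ ij, p ij = 1 := by
    rw [hsum]; simp
  have hu1 : ∑ i, u i = 1 := by
    rw [← hp1, Fintype.sum_prod_type]
    exact Finset.sum_congr rfl fun i _ => hu' i
  have hv1 : ∑ j, v j = 1 := by
    rw [← hp1, Fintype.sum_prod_type_right]
    exact Finset.sum_congr rfl fun i _ => hv' i
  have hp0 : ∀ ij, 0 ≤ p ij := fun ij => measureReal_nonneg
  have hl2 : (0 : ℝ) < Real.log 2 := Real.log_pos (by norm_num)
  -- Gibbs' inequality termwise: `log x ≤ x - 1` at `x = u v / p`. The last summand totals zero,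
  -- since `u v` and `p` both have mass one.
  have key : ∀ ij : ι × κ, -(p ij * Real.logb 2 (p ij)) ≤
      -(p ij * Real.logb 2 (u ij.1)) + -(p ij * Real.logb 2 (v ij.2)) +
        (u ij.1 * v ij.2 - p ij) / Real.log 2 := by
    rintro ⟨i, j⟩
    have hui : p (i, j) ≤ u i := by
      rw [hu']; exact Finset.single_le_sum (f := fun j => p (i, j)) (fun j _ => hp0 _)
        (Finset.mem_univ j)
    have hvj : p (i, j) ≤ v j := by
      rw [hv']; exact Finset.single_le_sum (f := fun i => p (i, j)) (fun i _ => hp0 _)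
        (Finset.mem_univ i)
    rcases (hp0 (i, j)).eq_or_lt with h0 | h0
    · have h1 : 0 ≤ u i * v j := mul_nonneg measureReal_nonneg measureReal_nonneg
      simp only [← h0, zero_mul, neg_zero, zero_add, sub_zero]
      exact div_nonneg h1 hl2.le
    · have hui0 := h0.trans_le hui
      have hvj0 := h0.trans_le hvj
      have hlog := Real.log_le_sub_one_of_pos (div_pos (mul_pos hui0 hvj0) h0)
      rw [Real.log_div (mul_pos hui0 hvj0).ne' h0.ne', Real.log_mul hui0.ne' hvj0.ne'] at hlog
      have h2 : p (i, j) * (Real.log (u i) + Real.log (v j) - Real.log (p (i, j))) ≤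
          u i * v j - p (i, j) := by
        calc _ ≤ p (i, j) * (u i * v j / p (i, j) - 1) := mul_le_mul_of_nonneg_left hlog h0.le
          _ = _ := by field_simp
      simp only [Real.logb]
      rw [← sub_nonneg]
      have : 0 ≤ (u i * v j - p (i, j) -
          p (i, j) * (Real.log (u i) + Real.log (v j) - Real.log (p (i, j)))) / Real.log 2 :=
        div_nonneg (by linarith) hl2.le
      refine this.trans_eq ?_
      field_simp
      ring
  have hA : ∑ ij : ι × κ, -(p ij * Real.logb 2 (u ij.1)) = partitionEntropy μ f := by
    rw [Fintype.sum_prod_type]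
    refine Finset.sum_congr rfl fun i _ => ?_
    dsimp only
    rw [Finset.sum_neg_distrib, ← Finset.sum_mul, ← hu' i]
  have hB : ∑ ij : ι × κ, -(p ij * Real.logb 2 (v ij.2)) = partitionEntropy μ g := by
    rw [Fintype.sum_prod_type_right]
    refine Finset.sum_congr rfl fun i _ => ?_
    dsimp only
    rw [Finset.sum_neg_distrib, ← Finset.sum_mul, ← hv' i]
  have hC : ∑ ij : ι × κ, (u ij.1 * v ij.2 - p ij) / Real.log 2 = 0 := by
    rw [← Finset.sum_div, Finset.sum_sub_distrib, hp1, Fintype.sum_prod_type]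
    simp only [← Finset.mul_sum, hv1, mul_one, hu1, sub_self, zero_div]
  calc partitionEntropy μ P = ∑ ij, -(p ij * Real.logb 2 (p ij)) := rfl
    _ ≤ _ := Finset.sum_le_sum fun ij _ => key ij
    _ = _ := by rw [Finset.sum_add_distrib, Finset.sum_add_distrib, hA, hB, hC, add_zero]

theorem measurableSet_itinerary {T : X → X} (hT : Measurable T) {f : X → ι}
    (hf : ∀ i, MeasurableSet (f ⁻¹' {i})) (n : ℕ) (w : Fin n → ι) :
    MeasurableSet (itinerary T f n ⁻¹' {w}) := by
  have : itinerary T f n ⁻¹' {w} = ⋂ t : Fin n, T^[t] ⁻¹' (f ⁻¹' {w t}) := by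
    ext x
    simp [itinerary, funext_iff]
  rw [this]
  exact MeasurableSet.iInter fun t => (hT.iterate t) (hf _)

theorem partitionEntropy_itinerary_le [Fintype ι] {μ : Measure X} [IsProbabilityMeasure μ]
    {T : X → X}
    (hT : MeasurePreserving T μ μ) {f : X → ι} (hf : ∀ i, MeasurableSet (f ⁻¹' {i})) (n : ℕ) :
    partitionEntropy μ (itinerary T f n) ≤ n * partitionEntropy μ f := by
  induction n with
  | zero =>
    have h1 : ∀ w : Fin 0 → ι, itinerary T f 0 ⁻¹' {w} = Set.univ := fun w => by
      ext x; simp [Subsingleton.elim (itinerary T f 0 x) w]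
    simp [partitionEntropy, h1]
  | succ n ih =>
    have hfn : ∀ i, MeasurableSet ((fun x => f (T^[n] x)) ⁻¹' {i}) := fun i =>
      (hT.measurable.iterate n) (hf i)
    have hin := measurableSet_itinerary hT.measurable hf n
    calc partitionEntropy μ (itinerary T f (n + 1))
        ≤ partitionEntropy μ (fun x => (itinerary T f n x, f (T^[n] x))) := by
          refine partitionEntropy_le_of_factors ?_ ?_
          · rintro ⟨w, i⟩
            have : (fun x => (itinerary T f n x, f (T^[n] x))) ⁻¹' {(w, i)} =
                itinerary T f n ⁻¹' {w} ∩ (fun x => f (T^[n] x)) ⁻¹' {i} := by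
              ext x; simp
            rw [this]
            exact (hin w).inter (hfn i)
          · intro a b hab
            rw [Prod.mk.injEq] at hab
            funext t
            refine Fin.lastCases ?_ (fun t => ?_) t
            · exact hab.2
            · exact congrFun hab.1 t
      _ ≤ _ := partitionEntropy_prod_le hin hfn
      _ ≤ n * partitionEntropy μ f + partitionEntropy μ f :=
          add_le_add ih (partitionEntropy_comp (hT.iterate n) hf).le
      _ = _ := by push_cast; ring

/-- An error variable which vanishes with high probability has small entropy. -/
theorem exists_partitionEntropy_lt (ι : Type*) [Fintype ι] {ε : ℝ} (hε : 0 < ε) :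
    ∃ δ : ENNReal, 0 < δ ∧ ∀ (μ : Measure X) [IsProbabilityMeasure μ] (e : X → Option ι),
      (∀ i, MeasurableSet (e ⁻¹' {i})) → μ {x | e x ≠ none} < δ → partitionEntropy μ e < ε := by
  set h : ℝ → ℝ := fun p => -(p * Real.logb 2 p) with hh
  have hcont : Continuous h := by
    have : h = fun p => Real.negMulLog p / Real.log 2 := by
      funext p; simp [hh, Real.negMulLog, Real.logb]; ring
    rw [this]
    exact Real.continuous_negMulLog.div_const _
  have h0 : h 0 = 0 := by simp [hh]
  have h1 : h 1 = 0 := by simp [hh]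
  -- The number of values of `e`: each cell may contribute `ε / N`, because `h` is continuous and
  -- vanishes at 0 and at 1.
  set N : ℝ := Fintype.card ι + 1 with hN
  have hNpos : 0 < N := by positivity
  have hεN : 0 < ε / N := div_pos hε hNpos
  obtain ⟨d0, hd0, H0⟩ := Metric.continuous_iff.1 hcont 0 _ hεN
  obtain ⟨d1, hd1, H1⟩ := Metric.continuous_iff.1 hcont 1 _ hεN
  refine ⟨ENNReal.ofReal (min d0 d1), by simp [hd0, hd1], ?_⟩
  intro μ _ e he hμ
  have hμ' : μ.real {x | e x ≠ none} < min d0 d1 := by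
    rw [measureReal_def]
    exact (ENNReal.lt_ofReal_iff_toReal_lt (measure_ne_top _ _)).1 hμ
  have hsome : ∀ i : ι, h (μ.real (e ⁻¹' {some i})) < ε / N := by
    intro i
    have hle : μ.real (e ⁻¹' {some i}) ≤ μ.real {x | e x ≠ none} :=
      measureReal_mono fun x hx => by
        simp only [Set.mem_preimage, Set.mem_singleton_iff] at hx
        simp [hx]
    have := H0 (μ.real (e ⁻¹' {some i})) (by
      rw [Real.dist_eq, sub_zero, abs_of_nonneg measureReal_nonneg]
      exact (hle.trans_lt hμ').trans_le (min_le_left _ _))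
    rw [h0, Real.dist_eq, sub_zero] at this
    exact (le_abs_self _).trans_lt this
  have hnone : h (μ.real (e ⁻¹' {none})) < ε / N := by
    have hc : μ.real {x | e x ≠ none} = 1 - μ.real (e ⁻¹' {none}) := by
      rw [← probReal_compl_eq_one_sub (he none)]
      rfl
    have := H1 (μ.real (e ⁻¹' {none})) (by
      rw [Real.dist_eq, abs_sub_comm, ← hc, abs_of_nonneg measureReal_nonneg]
      exact hμ'.trans_le (min_le_right _ _))
    rw [h1, Real.dist_eq, sub_zero] at this
    exact (le_abs_self _).trans_lt this
  calc partitionEntropy μ e = h (μ.real (e ⁻¹' {none})) + ∑ i, h (μ.real (e ⁻¹' {some i})) :=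
        Fintype.sum_option _
    _ < ε / N + ∑ _i : ι, ε / N :=
        add_lt_add_of_lt_of_le hnone (Finset.sum_le_sum fun i _ => (hsome i).le)
    _ = ε := by
        rw [Finset.sum_const, nsmul_eq_mul, Finset.card_univ]
        rw [hN]; field_simp; ring

end Entropy

/-! ### Blocks and bipermutative local rules -/

section Combinatorics

variable {A : Type*}

/-- The block of length `n` of a sequence starting at position `z`. -/
def block (z : ℤ) (n : ℕ) (a : ℤ → A) : Fin n → A := fun i => a (z + (i : ℕ))

theorem block_eq_iff {z : ℤ} {n : ℕ} {a b : ℤ → A} :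
    block z n a = block z n b ↔ ∀ t, z ≤ t → t < z + n → a t = b t := by
  constructor
  · intro h t h1 h2
    have := congrFun h ⟨(t - z).toNat, by omega⟩
    simp only [block] at this
    rwa [show z + (((t - z).toNat : ℕ) : ℤ) = t by omega] at this
  · intro h
    funext i
    exact h _ (by omega) (by have := i.2; omega)

variable {Φ : (ℤ → A) → (ℤ → A)} {ℓ r : ℕ} {φ : (Fin (ℓ + r + 1) → A) → A}

theorem HasLocalRule.apply_eq (h : HasLocalRule Φ ℓ r φ) {a b : ℤ → A} {z : ℤ}
    (hab : ∀ t, z - ℓ ≤ t → t ≤ z + r → a t = b t) : Φ a z = Φ b z := by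
  rw [h, h]
  congr 1
  funext i
  have := i.2
  exact hab _ (by omega) (by omega)

theorem HasLocalRule.iterate_eq (h : HasLocalRule Φ ℓ r φ) {a b : ℤ → A} (n : ℕ) {p q : ℤ}
    (hab : ∀ t, p - n * ℓ ≤ t → t < q + n * r → a t = b t) :
    ∀ t, p ≤ t → t < q → Φ^[n] a t = Φ^[n] b t := by
  induction n generalizing p q with
  | zero => simpa using hab
  | succ n ih =>
    intro t h1 h2
    rw [Function.iterate_succ_apply', Function.iterate_succ_apply']
    refine h.apply_eq fun t' h3 h4 => ih (p := p - ℓ) (q := q + r) ?_ t' (by omega) (by omega)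
    intro t'' h5 h6
    push_cast at hab
    exact hab t'' (by linarith) (by linarith)

theorem HasLocalRule.update_right (h : HasLocalRule Φ ℓ r φ) (a : ℤ → A) (z : ℤ) (c : A) :
    Φ (Function.update a (z + r) c) z =
      φ (Function.update (fun i : Fin (ℓ + r + 1) => a (z - (ℓ : ℤ) + ((i : ℕ) : ℤ)))
        (Fin.last (ℓ + r)) c) := by
  rw [h]
  congr 1
  funext i
  by_cases hi : i = Fin.last (ℓ + r)
  · subst hi
    rw [Function.update_self, show z - (ℓ : ℤ) + (((Fin.last (ℓ + r) : Fin _) : ℕ) : ℤ) = z + r by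
      simp; ring, Function.update_self]
  · rw [Function.update_of_ne hi, Function.update_of_ne]
    intro hc
    exact hi (Fin.ext (by simp; omega))

theorem HasLocalRule.update_left (h : HasLocalRule Φ ℓ r φ) (a : ℤ → A) (z : ℤ) (c : A) :
    Φ (Function.update a (z - ℓ) c) z =
      φ (Function.update (fun i : Fin (ℓ + r + 1) => a (z - (ℓ : ℤ) + ((i : ℕ) : ℤ))) 0 c) := by
  rw [h]
  congr 1
  funext i
  by_cases hi : i = 0
  · subst hi
    simp
  · rw [Function.update_of_ne hi, Function.update_of_ne]
    intro hc
    exact hi (Fin.ext (by rw [Fin.val_zero]; omega))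

/-- Writing `b`'s value at `z + r` into `a` leaves the image at `z` unchanged, so injectivity in the
last variable identifies the two values. -/
theorem HasLocalRule.eq_right (h : HasLocalRule Φ ℓ r φ) (hR : RightPermutative φ)
    {a b : ℤ → A} {z : ℤ} (hab : ∀ t, z - ℓ ≤ t → t < z + r → a t = b t)
    (hΦ : Φ a z = Φ b z) : a (z + r) = b (z + r) := by
  have h1 : Φ (Function.update a (z + r) (b (z + r))) z = Φ b z := by
    refine h.apply_eq fun t h1 h2 => ?_
    rcases eq_or_ne t (z + r) with rfl | ht
    · rw [Function.update_self]
    · rw [Function.update_of_ne ht]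
      exact hab t h1 (by omega)
  have h2 : Φ (Function.update a (z + r) (a (z + r))) z = Φ b z := by
    rw [Function.update_eq_self, hΦ]
  rw [h.update_right] at h1 h2
  exact (hR _).1 (h2.trans h1.symm)

theorem HasLocalRule.eq_left (h : HasLocalRule Φ ℓ r φ) (hL : LeftPermutative φ)
    {a b : ℤ → A} {z : ℤ} (hab : ∀ t, z - ℓ < t → t ≤ z + r → a t = b t)
    (hΦ : Φ a z = Φ b z) : a (z - ℓ) = b (z - ℓ) := by
  have h1 : Φ (Function.update a (z - ℓ) (b (z - ℓ))) z = Φ b z := by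
    refine h.apply_eq fun t h1 h2 => ?_
    rcases eq_or_ne t (z - ℓ) with rfl | ht
    · rw [Function.update_self]
    · rw [Function.update_of_ne ht]
      exact hab t (by omega) h2
  have h2 : Φ (Function.update a (z - ℓ) (a (z - ℓ))) z = Φ b z := by
    rw [Function.update_eq_self, hΦ]
  rw [h.update_left] at h1 h2
  exact (hL _).1 (h2.trans h1.symm)

/-- A sequence is determined on `[p - ℓ, q + r)` by its values on `[c - ℓ, c + r)` and the values
of its image on `[p, q)`, when `p ≤ c ≤ q`. -/
theorem HasLocalRule.eq_of_eq (h : HasLocalRule Φ ℓ r φ) (hL : LeftPermutative φ)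
    (hR : RightPermutative φ) {a b : ℤ → A} {c p q : ℤ} (hpc : p ≤ c) (hcq : c ≤ q)
    (hab : ∀ t, c - ℓ ≤ t → t < c + r → a t = b t)
    (hΦ : ∀ t, p ≤ t → t < q → Φ a t = Φ b t) :
    ∀ t, p - ℓ ≤ t → t < q + r → a t = b t := by
  -- The known window grows one cell at a time, to the right first and then, over the widened
  -- window, to the left.
  have hright : ∀ k : ℕ, c + k ≤ q → ∀ t, c - ℓ ≤ t → t < c + k + r → a t = b t := by
    intro k
    induction k with
    | zero => simpa using fun _ => hab
    | succ k ih =>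
      intro hk t h1 h2
      push_cast at hk h2
      by_cases ht : t < c + k + r
      · exact ih (by omega) t h1 ht
      · obtain rfl : t = c + k + r := by omega
        exact h.eq_right hR (fun t h3 h4 => ih (by omega) t (by omega) h4)
          (hΦ _ (by omega) (by omega))
  have hright' : ∀ t, c - ℓ ≤ t → t < q + r → a t = b t := fun t h1 h2 =>
    hright (q - c).toNat (by omega) t h1 (by omega)
  have hleft : ∀ k : ℕ, p ≤ c - k → ∀ t, c - k - ℓ ≤ t → t < q + r → a t = b t := by
    intro k
    induction k with
    | zero => simpa using fun _ => hright'
    | succ k ih =>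
      intro hk t h1 h2
      push_cast at hk h1
      by_cases ht : c - k - ℓ ≤ t
      · exact ih (by omega) t ht h2
      · obtain rfl : t = c - (k + 1) - ℓ := by omega
        exact h.eq_left hL (fun t h3 h4 => ih (by omega) t (by omega) (by omega))
          (hΦ _ (by omega) (by omega))
  exact fun t h1 h2 => hleft (c - p).toNat (by omega) t (by omega) h2

theorem HasLocalRule.eq_of_image_eq (h : HasLocalRule Φ ℓ r φ) (hL : LeftPermutative φ)
    (hR : RightPermutative φ) {a b : ℤ → A} {c : ℤ}
    (hab : ∀ t, c - ℓ ≤ t → t < c + r → a t = b t) (hΦ : Φ a = Φ b) : a = b := by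
  funext t
  exact h.eq_of_eq hL hR (p := c - |t - c| - r - ℓ - 1) (q := c + |t - c| + ℓ + 1)
    (by have := abs_nonneg (t - c); omega) (by have := abs_nonneg (t - c); omega) hab
    (fun t _ _ => by rw [hΦ]) t (by have := neg_abs_le (t - c); omega)
    (by have := le_abs_self (t - c); omega)

/-- Each step solves for one new cell at either end; these cells lie outside the neighbourhoods of
the image values already fixed. -/
theorem HasLocalRule.exists_preimage_window (h : HasLocalRule Φ ℓ r φ) (hL : LeftPermutative φ)
    (hR : RightPermutative φ) (b w : ℤ → A) (c : ℤ) (n : ℕ) :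
    ∃ a, (∀ t, c - ℓ ≤ t → t < c + r → a t = w t) ∧
      ∀ t, c - n ≤ t → t < c + n → Φ a t = b t := by
  induction n with
  | zero => exact ⟨w, fun _ _ _ => rfl, fun t h1 h2 => by simp at h1 h2; omega⟩
  | succ n ih =>
    obtain ⟨a, ha, hΦ⟩ := ih
    obtain ⟨x, hx⟩ := (hR fun i => a (c + n - (ℓ : ℤ) + ((i : ℕ) : ℤ))).2 (b (c + n))
    dsimp only at hx
    rw [← h.update_right] at hx
    set a₁ := Function.update a (c + n + r) x with ha₁
    have e₁ : ∀ t, t < c + n + r → a₁ t = a t := fun t ht => Function.update_of_ne (by omega) _ _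
    obtain ⟨y, hy⟩ := (hL fun i => a₁ (c - (n + 1) - (ℓ : ℤ) + ((i : ℕ) : ℤ))).2 (b (c - (n + 1)))
    dsimp only at hy
    rw [← h.update_left] at hy
    set a₂ := Function.update a₁ (c - (n + 1) - ℓ) y with ha₂
    have e₂ : ∀ t, c - (n + 1) - ℓ < t → a₂ t = a₁ t := fun t ht =>
      Function.update_of_ne (by omega) _ _
    refine ⟨a₂, fun t h1 h2 => ?_, fun t h1 h2 => ?_⟩
    · rw [e₂ t (by omega), e₁ t (by omega), ha t h1 h2]
    · push_cast at h1 h2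
      rcases eq_or_ne t (c - (n + 1)) with rfl | h3
      · exact hy
      · rw [h.apply_eq fun t' _ _ => e₂ t' (by omega)]
        rcases eq_or_ne t (c + n) with rfl | h4
        · exact hx
        · rw [h.apply_eq fun t' _ _ => e₁ t' (by omega)]
          exact hΦ t (by omega) (by omega)

/-- Each point of `A^ℤ` has exactly one preimage with given values on `[c - ℓ, c + r)`. -/
theorem HasLocalRule.exists_preimage [Finite A] [TopologicalSpace A] [DiscreteTopology A]
    (h : HasLocalRule Φ ℓ r φ) (hL : LeftPermutative φ)
    (hR : RightPermutative φ) (hc : Continuous Φ) (b w : ℤ → A) (c : ℤ) :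
    ∃ a, (∀ t, c - ℓ ≤ t → t < c + r → a t = w t) ∧ Φ a = b := by
  -- Solutions on finite windows form a decreasing sequence of nonempty compact sets.
  set C : ℕ → Set (ℤ → A) := fun n => {a | (∀ t, c - ℓ ≤ t → t < c + r → a t = w t) ∧
      ∀ t, c - n ≤ t → t < c + n → Φ a t = b t} with hC
  have hcl : ∀ n, IsClosed (C n) := by
    intro n
    have : C n = (⋂ t, ⋂ (_ : c - ℓ ≤ t), ⋂ (_ : t < c + r), {a | a t = w t}) ∩
        ⋂ t, ⋂ (_ : c - n ≤ t), ⋂ (_ : t < c + n), {a | Φ a t = b t} := by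
      ext a; simp [hC]
    rw [this]
    refine IsClosed.inter ?_ ?_
    · exact isClosed_iInter fun t => isClosed_iInter fun _ => isClosed_iInter fun _ =>
        isClosed_eq (continuous_apply t) continuous_const
    · exact isClosed_iInter fun t => isClosed_iInter fun _ => isClosed_iInter fun _ =>
        isClosed_eq ((continuous_apply t).comp hc) continuous_const
  obtain ⟨a, ha⟩ := IsCompact.nonempty_iInter_of_sequence_nonempty_isCompact_isClosed C
    (fun n a ha => ⟨ha.1, fun t h1 h2 => ha.2 t (by push_cast; omega) (by push_cast; omega)⟩)
    (fun n => h.exists_preimage_window hL hR b w c n) (hcl 0).isCompact hcl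
  rw [Set.mem_iInter] at ha
  refine ⟨a, (ha 0).1, ?_⟩
  funext t
  exact (ha ((t - c).natAbs + 1)).2 t (by omega) (by omega)

end Combinatorics

/-! ### Vanishing of the entropy of an almost everywhere injective bipermutative automaton -/

section ZeroEntropy

variable {A : Type*} [MeasurableSpace A]

theorem measurable_shift : Measurable (shift : (ℤ → A) → (ℤ → A)) :=
  measurable_pi_lambda _ fun z => measurable_pi_apply (z - 1)

theorem measurableSet_block [MeasurableSingletonClass A] (z : ℤ) (n : ℕ) (w : Fin n → A) :
    MeasurableSet ((block z n : (ℤ → A) → _) ⁻¹' {w}) := by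
  have : (block z n : (ℤ → A) → _) ⁻¹' {w} =
      ⋂ i : Fin n, (fun a : ℤ → A => a (z + (i : ℕ))) ⁻¹' {w i} := by
    ext a; simp [block, funext_iff]
  rw [this]
  exact MeasurableSet.iInter fun i => measurable_pi_apply _ (measurableSet_singleton _)

theorem partitionEntropy_block [MeasurableSingletonClass A] [Fintype A] {μ : Measure (ℤ → A)}
    (hσ : MeasurePreserving shift μ μ) (z : ℤ) (n : ℕ) :
    partitionEntropy μ (block z n) = partitionEntropy μ (block 0 n) := by
  have step : ∀ z : ℤ, partitionEntropy μ (block (z + 1) n) = partitionEntropy μ (block z n) := by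
    intro z
    rw [← partitionEntropy_comp hσ (measurableSet_block (z + 1) n)]
    congr 1
    funext a i
    simp only [block, shift]
    congr 1
    ring
  induction z with
  | zero => rfl
  | succ k ih => rw [step, ih]
  | pred k ih => rw [← step, sub_add_cancel, ih]

variable [Fintype A] [TopologicalSpace A] [DiscreteTopology A] [BorelSpace A]

/-- A finite partition which is a function of `Φ` on a set of full measure is determined by a
central block of the image, up to an error. -/
theorem exists_block_approx {ι : Type*} [Finite ι] {μ : Measure (ℤ → A)} [IsProbabilityMeasure μ]
    {Φ : (ℤ → A) → (ℤ → A)} (hΦ : Continuous Φ) {η : (ℤ → A) → ι}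
    (hη : ∀ i, MeasurableSet (η ⁻¹' {i})) {S : Set (ℤ → A)} (hS : MeasurableSet S)
    (hS0 : μ Sᶜ = 0) (hinj : ∀ a ∈ S, ∀ b ∈ S, Φ a = Φ b → η a = η b)
    {δ : ENNReal} (hδ : δ ≠ 0) :
    ∃ (M : ℕ) (g : (Fin (2 * M) → A) → ι),
      μ {a | g (block (-M) (2 * M) (Φ a)) ≠ η a} < δ := by
  classical
  obtain ⟨x₀⟩ : Nonempty (ℤ → A) := nonempty_of_isProbabilityMeasure μ
  obtain ⟨δ', hδ', hsum⟩ := ENNReal.exists_pos_sum_of_countable hδ ι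
  have hK : ∀ i, ∃ K, K ⊆ S ∩ η ⁻¹' {i} ∧ IsCompact K ∧ μ ((S ∩ η ⁻¹' {i}) \ K) < δ' i :=
    fun i => (hS.inter (hη i)).exists_isCompact_sdiff_lt (measure_ne_top _ _)
      (by exact_mod_cast (hδ' i).ne')
  choose K hKS hKc hKμ using hK
  have hKη : ∀ i, ∀ a ∈ K i, η a = i := fun i a ha => (hKS i ha).2
  -- Pairs of points in the compact cores of different cells. By compactness, if every window failed
  -- to separate the images of some such pair, one pair would have equal images, against `hinj`.
  set D : Set ((ℤ → A) × (ℤ → A)) := ⋃ p : {p : ι × ι // p.1 ≠ p.2}, K p.1.1 ×ˢ K p.1.2 with hD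
  have hDc : IsCompact D := isCompact_iUnion fun p => (hKc _).prod (hKc _)
  have hmemD : ∀ a b, (a, b) ∈ D → a ∈ S ∧ b ∈ S ∧ η a ≠ η b := by
    intro a b hab
    obtain ⟨⟨⟨i, j⟩, hij⟩, hp⟩ := Set.mem_iUnion.1 hab
    refine ⟨(hKS _ hp.1).1, (hKS _ hp.2).1, ?_⟩
    rw [hKη i a hp.1, hKη j b hp.2]
    exact hij
  set C : ℕ → Set ((ℤ → A) × (ℤ → A)) := fun n =>
    D ∩ {p | ∀ t, -(n : ℤ) ≤ t → t < -(n : ℤ) + (2 * n : ℕ) → Φ p.1 t = Φ p.2 t} with hC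
  have hCcl : ∀ n, IsClosed (C n) := by
    intro n
    refine hDc.isClosed.inter ?_
    simp only [Set.ofPred_forall]
    exact isClosed_iInter fun t => isClosed_iInter fun _ => isClosed_iInter fun _ =>
        isClosed_eq ((continuous_apply t).comp (hΦ.comp continuous_fst))
          ((continuous_apply t).comp (hΦ.comp continuous_snd))
  have hM : ∃ M, ¬ (C M).Nonempty := by
    by_contra! hne
    obtain ⟨⟨a, b⟩, hab⟩ := IsCompact.nonempty_iInter_of_sequence_nonempty_isCompact_isClosed C
      (fun n p hp => ⟨hp.1, fun t h1 h2 =>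
        hp.2 t (by push_cast; omega) (by push_cast at h2 ⊢; omega)⟩)
      hne (hDc.of_isClosed_subset (hCcl 0) Set.inter_subset_left) hCcl
    rw [Set.mem_iInter] at hab
    obtain ⟨h1, h2, h3⟩ := hmemD a b (hab 0).1
    refine h3 (hinj a h1 b h2 ?_)
    funext t
    exact (hab (t.natAbs + 1)).2 t (by omega) (by omega)
  obtain ⟨M, hM⟩ := hM
  have hsep : ∀ a ∈ ⋃ i, K i, ∀ b ∈ ⋃ i, K i,
      block (-M) (2 * M) (Φ a) = block (-M) (2 * M) (Φ b) → η a = η b := by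
    intro a ha b hb hab
    by_contra hne
    obtain ⟨i, hi⟩ := Set.mem_iUnion.1 ha
    obtain ⟨j, hj⟩ := Set.mem_iUnion.1 hb
    refine hM ⟨(a, b), Set.mem_iUnion.2 ⟨⟨(i, j), ?_⟩, hi, hj⟩, block_eq_iff.1 hab⟩
    rwa [hKη i a hi, hKη j b hj] at hne
  set g : (Fin (2 * M) → A) → ι := fun w =>
    if h : ∃ a ∈ ⋃ i, K i, block (-M) (2 * M) (Φ a) = w then η h.choose else η x₀ with hg
  refine ⟨M, g, ?_⟩
  have hgood : ∀ a ∈ ⋃ i, K i, g (block (-M) (2 * M) (Φ a)) = η a := by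
    intro a ha
    have h : ∃ b ∈ ⋃ i, K i, block (-M) (2 * M) (Φ b) = block (-M) (2 * M) (Φ a) := ⟨a, ha, rfl⟩
    rw [hg]
    simp only [dif_pos h]
    exact hsep _ h.choose_spec.1 _ ha h.choose_spec.2
  calc μ {a | g (block (-M) (2 * M) (Φ a)) ≠ η a}
      ≤ μ (Sᶜ ∪ ⋃ i, ((S ∩ η ⁻¹' {i}) \ K i)) := by
        refine measure_mono fun a ha => ?_
        by_cases haS : a ∈ S
        · refine Or.inr (Set.mem_iUnion.2 ⟨η a, ⟨haS, rfl⟩, fun haK => ?_⟩)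
          exact ha (hgood a (Set.mem_iUnion.2 ⟨_, haK⟩))
        · exact Or.inl haS
    _ ≤ μ Sᶜ + ∑' i, μ ((S ∩ η ⁻¹' {i}) \ K i) :=
        (measure_union_le _ _).trans (add_le_add le_rfl (measure_iUnion_le _))
    _ ≤ 0 + ∑' i, (δ' i : ENNReal) :=
        add_le_add hS0.le (ENNReal.tsum_le_tsum fun i => (hKμ i).le)
    _ < δ := by rwa [zero_add]

variable [MeasurableSingletonClass A]

/-- As `exists_block_approx`, the error being recorded by a variable of small entropy. -/
theorem exists_block_error {ι : Type*} [Fintype ι] {μ : Measure (ℤ → A)}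
    [IsProbabilityMeasure μ]
    {Φ : (ℤ → A) → (ℤ → A)} (hΦ : Continuous Φ) {η : (ℤ → A) → ι}
    (hη : ∀ i, MeasurableSet (η ⁻¹' {i})) {S : Set (ℤ → A)} (hS : MeasurableSet S)
    (hS0 : μ Sᶜ = 0) (hinj : ∀ a ∈ S, ∀ b ∈ S, Φ a = Φ b → η a = η b)
    {ε : ℝ} (hε : 0 < ε) :
    ∃ (M : ℕ) (e : (ℤ → A) → Option ι), (∀ i, MeasurableSet (e ⁻¹' {i})) ∧
      partitionEntropy μ e < ε ∧ ∀ a b, e a = e b →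
        block (-M) (2 * M) (Φ a) = block (-M) (2 * M) (Φ b) → η a = η b := by
  classical
  obtain ⟨δ, hδ, H⟩ := exists_partitionEntropy_lt (X := ℤ → A) ι hε
  obtain ⟨M, g, hg⟩ := exists_block_approx hΦ hη hS hS0 hinj hδ.ne'
  have hgm : ∀ i, MeasurableSet ((fun a => g (block (-M) (2 * M) (Φ a))) ⁻¹' {i}) := fun i =>
    measurableSet_preimage_of_factors (f := fun a => block (-M) (2 * M) (Φ a))
      (fun w => hΦ.measurable (measurableSet_block (-M) (2 * M) w))
      (fun a b hab => congrArg g hab) i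
  -- The error is `none` when the guess `g` is right and otherwise the true label, so the image
  -- block and `e` together determine `η`.
  set e : (ℤ → A) → Option ι := fun a =>
    if g (block (-M) (2 * M) (Φ a)) = η a then none else some (η a) with he
  have hem : ∀ i, MeasurableSet (e ⁻¹' {i}) := by
    refine measurableSet_preimage_of_factors
      (f := fun a => (g (block (-M) (2 * M) (Φ a)), η a)) ?_ ?_
    · rintro ⟨i, j⟩
      have : (fun a => (g (block (-M) (2 * M) (Φ a)), η a)) ⁻¹' {(i, j)} =
          (fun a => g (block (-M) (2 * M) (Φ a))) ⁻¹' {i} ∩ η ⁻¹' {j} := by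
        ext a; simp
      rw [this]
      exact (hgm i).inter (hη j)
    · intro a b hab
      rw [Prod.mk.injEq] at hab
      simp only [he, hab.1, hab.2]
  refine ⟨M, e, hem, H μ e hem ?_, ?_⟩
  · refine lt_of_eq_of_lt (congrArg μ ?_) hg
    ext a
    simp [he]
  · intro a b hab hblock
    simp only [he, hblock] at hab
    split_ifs at hab with h1 h2 h2
    · exact h1.symm.trans h2
    · exact Option.some_injective _ hab

variable {Φ : (ℤ → A) → (ℤ → A)} {ℓ r : ℕ} {φ : (Fin (ℓ + r + 1) → A) → A}
  {μ : Measure (ℤ → A)} [IsProbabilityMeasure μ]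

/-- Almost everywhere injectivity recovers the central block from the image at cost `ε`; with it, an
image block of length `N` determines a block longer by `ℓ + r`. -/
theorem exists_blockEntropy_add_le (h : HasLocalRule Φ ℓ r φ) (hL : LeftPermutative φ)
    (hR : RightPermutative φ) (hc : Continuous Φ) (hσ : MeasurePreserving shift μ μ)
    (hΦ : MeasurePreserving Φ μ μ) {S : Set (ℤ → A)} (hS : MeasurableSet S) (hS0 : μ Sᶜ = 0)
    (hinj : Set.InjOn Φ S) {ε : ℝ} (hε : 0 < ε) :
    ∃ N₀ : ℕ, ∀ N ≥ N₀, partitionEntropy μ (block 0 (N + (ℓ + r))) ≤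
      partitionEntropy μ (block 0 N) + ε := by
  obtain ⟨M, e, hem, heε, he⟩ := exists_block_error (μ := μ) hc
    (measurableSet_block (A := A) (-ℓ) (ℓ + r)) hS hS0
    (fun a ha b hb hab => by rw [hinj ha hb hab]) hε
  refine ⟨2 * M, fun N hN => ?_⟩
  have hbm : ∀ w, MeasurableSet ((fun a => block (-M) N (Φ a)) ⁻¹' {w}) := fun w =>
    hc.measurable (measurableSet_block (-M) N w)
  calc partitionEntropy μ (block 0 (N + (ℓ + r)))
      = partitionEntropy μ (block (-M - ℓ) (N + (ℓ + r))) := (partitionEntropy_block hσ _ _).symm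
    _ ≤ partitionEntropy μ (fun a => (block (-M) N (Φ a), e a)) := by
      refine partitionEntropy_le_of_factors ?_ ?_
      · rintro ⟨w, i⟩
        have : (fun a => (block (-M) N (Φ a), e a)) ⁻¹' {(w, i)} =
            (fun a => block (-M) N (Φ a)) ⁻¹' {w} ∩ e ⁻¹' {i} := by
          ext a; simp
        rw [this]
        exact (hbm w).inter (hem i)
      · intro a b hab
        rw [Prod.mk.injEq] at hab
        have h1 := block_eq_iff.1 hab.1
        have h2 := block_eq_iff.1 (he a b hab.2
          (block_eq_iff.2 fun t h3 h4 => h1 t h3 (by push_cast at h4; omega)))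
        rw [block_eq_iff]
        intro t h3 h4
        push_cast at h4 h2
        exact h.eq_of_eq hL hR (c := 0) (p := -M) (q := -M + N) (by omega) (by omega)
          (fun t h5 h6 => h2 t (by omega) (by omega)) h1 t h3 (by omega)
    _ ≤ partitionEntropy μ (fun a => block (-M) N (Φ a)) + partitionEntropy μ e :=
      partitionEntropy_prod_le hbm hem
    _ ≤ partitionEntropy μ (block 0 N) + ε := by
      refine add_le_add (le_of_eq ?_) heε.le
      rw [partitionEntropy_comp hΦ (measurableSet_block (-M) N), partitionEntropy_block hσ]

theorem exists_blockEntropy_le (h : HasLocalRule Φ ℓ r φ) (hL : LeftPermutative φ)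
    (hR : RightPermutative φ) (hc : Continuous Φ) (hσ : MeasurePreserving shift μ μ)
    (hΦ : MeasurePreserving Φ μ μ) {S : Set (ℤ → A)} (hS : MeasurableSet S) (hS0 : μ Sᶜ = 0)
    (hinj : Set.InjOn Φ S) {ε : ℝ} (hε : 0 < ε) (c : ℕ) :
    ∃ C : ℝ, ∀ n : ℕ, partitionEntropy μ (block 0 (c + n * (ℓ + r))) ≤ C + n * ε := by
  obtain ⟨N₀, H⟩ := exists_blockEntropy_add_le h hL hR hc hσ hΦ hS hS0 hinj hε
  -- Starting from length `max c N₀` makes the increment bound available at every step.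
  refine ⟨partitionEntropy μ (block 0 (max c N₀)), fun n => ?_⟩
  have hmono : partitionEntropy μ (block 0 (c + n * (ℓ + r))) ≤
      partitionEntropy μ (block 0 (max c N₀ + n * (ℓ + r))) := by
    refine partitionEntropy_le_of_factors (measurableSet_block _ _) fun a b hab => ?_
    rw [block_eq_iff] at hab ⊢
    have := le_max_left c N₀
    exact fun t h1 h2 => hab t h1 (by push_cast at h2 ⊢; omega)
  refine hmono.trans ?_
  clear hmono
  induction n with
  | zero =>
    rw [Nat.zero_mul, Nat.add_zero]
    simp
  | succ n ih =>
    have := H (max c N₀ + n * (ℓ + r)) (by have := le_max_right c N₀; omega)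
    rw [add_assoc, ← Nat.succ_mul] at this
    push_cast
    linarith

/-- Up to a small error, `η` depends on a central block; `n` iterates widen that block by `n * ℓ`
and `n * r`, while the errors cost at most `ε` per iterate. -/
theorem partitionEntropy_itinerary_le_block (h : HasLocalRule Φ ℓ r φ) (hc : Continuous Φ)
    (hσ : MeasurePreserving shift μ μ) (hΦ : MeasurePreserving Φ μ μ) {ι : Type*} [Fintype ι]
    {η : (ℤ → A) → ι} (hη : ∀ i, MeasurableSet (η ⁻¹' {i})) {ε : ℝ} (hε : 0 < ε) :
    ∃ c : ℕ, ∀ n : ℕ, partitionEntropy μ (itinerary Φ η n) ≤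
      partitionEntropy μ (block 0 (c + n * (ℓ + r))) + n * ε := by
  obtain ⟨M, e, hem, heε, he⟩ := exists_block_error (μ := μ) (Φ := id) continuous_id hη
    MeasurableSet.univ (by simp) (fun a _ b _ hab => by rw [show a = b from hab]) hε
  refine ⟨2 * M, fun n => ?_⟩
  have hbm := measurableSet_block (A := A) (-M - n * ℓ) (2 * M + n * (ℓ + r))
  have him := measurableSet_itinerary hc.measurable hem n
  calc
    partitionEntropy μ (itinerary Φ η n) ≤ partitionEntropy μ (fun a =>
          (block (-M - n * ℓ) (2 * M + n * (ℓ + r)) a, itinerary Φ e n a)) := by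
      refine partitionEntropy_le_of_factors ?_ ?_
      · rintro ⟨w, i⟩
        have : (fun a => (block (-M - n * ℓ) (2 * M + n * (ℓ + r)) a, itinerary Φ e n a)) ⁻¹'
            {(w, i)} = block (-M - n * ℓ) (2 * M + n * (ℓ + r)) ⁻¹' {w} ∩
              itinerary Φ e n ⁻¹' {i} := by
          ext a; simp
        rw [this]
        exact (hbm w).inter (him i)
      · intro a b hab
        rw [Prod.mk.injEq] at hab
        funext t
        refine he _ _ (congrFun hab.2 t) ?_
        have h1 := block_eq_iff.1 hab.1
        rw [block_eq_iff]
        refine h.iterate_eq t fun t' h2 h3 => h1 t' ?_ ?_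
        · have : ((t : ℕ) : ℤ) * ℓ ≤ n * ℓ := by
            have := t.2; gcongr
          linarith
        · have : ((t : ℕ) : ℤ) * r ≤ n * r := by
            have := t.2; gcongr
          push_cast at h3 ⊢
          linarith
    _ ≤ _ := partitionEntropy_prod_le hbm him
    _ ≤ _ := by
      refine add_le_add (partitionEntropy_block hσ _ _).le
        ((partitionEntropy_itinerary_le hΦ hem n).trans ?_)
      gcongr

/-- A bipermutative cellular automaton which is injective on a set of full measure has entropy
zero with respect to an invariant measure. -/
theorem entropy_eq_zero_of_injOn (h : HasLocalRule Φ ℓ r φ) (hL : LeftPermutative φ)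
    (hR : RightPermutative φ) (hc : Continuous Φ) (hσ : MeasurePreserving shift μ μ)
    (hΦ : MeasurePreserving Φ μ μ) {S : Set (ℤ → A)} (hS : MeasurableSet S) (hS0 : μ Sᶜ = 0)
    (hinj : Set.InjOn Φ S) : entropy μ Φ = 0 := by
  refine le_antisymm (iSup_le fun k => iSup_le fun η => iSup_le fun hη => ?_) zero_le
  refine ENNReal.le_of_forall_pos_le_add fun ε hε _ => ?_
  rw [zero_add]
  -- One third each for the itinerary errors, the growth of block entropy and the term `C / n`.
  have hε3 : (0 : ℝ) < ε / 3 := by positivity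
  obtain ⟨c, H1⟩ := partitionEntropy_itinerary_le_block (μ := μ) h hc hσ hΦ
    (fun i => hη (measurableSet_singleton i)) hε3
  obtain ⟨C, H2⟩ := exists_blockEntropy_le h hL hR hc hσ hΦ hS hS0 hinj hε3 c
  refine limsup_le_of_le (by isBoundedDefault) ?_
  have hlim : Tendsto (fun n : ℕ => C / (n : ℝ)) atTop (𝓝 0) :=
    tendsto_const_div_atTop_nhds_zero_nat C
  filter_upwards [hlim.eventually_lt_const hε3, eventually_gt_atTop 0] with n hn hn0
  rw [← ENNReal.ofReal_coe_nnreal]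
  refine ENNReal.ofReal_le_ofReal ?_
  have hn0' : (0 : ℝ) < n := by exact_mod_cast hn0
  rw [div_lt_iff₀ hn0'] at hn
  rw [div_le_iff₀ hn0']
  have := H1 n
  have := H2 n
  linarith

end ZeroEntropy

/-! ### Conditional measures on the cosets of a finite invariant subgroup -/

section Cosets

variable {G : Type*} [Group G] [MeasurableSpace G]

/-- The sum of the right translates of a measure by the elements of a finite subgroup. -/
def translateSum (μ : Measure G) (K : Subgroup G) [Fintype K] : Measure G :=
  ∑ k : K, μ.map (· * (k : G))

variable [MeasurableMul G] {μ : Measure G} {K : Subgroup G} [Fintype K]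

theorem translateSum_apply {s : Set G} (hs : MeasurableSet s) :
    translateSum μ K s = ∑ k : K, μ ((· * (k : G)) ⁻¹' s) := by
  rw [translateSum, Measure.finsetSum_apply]
  exact Finset.sum_congr rfl fun k _ => Measure.map_apply (measurable_mul_const _) hs

instance [IsFiniteMeasure μ] : IsFiniteMeasure (translateSum μ K) := by
  refine ⟨?_⟩
  rw [translateSum_apply MeasurableSet.univ]
  exact ENNReal.sum_lt_top.2 fun k _ => measure_lt_top _ _

theorem absolutelyContinuous_translateSum : μ ≪ translateSum μ K := by
  refine Measure.AbsolutelyContinuous.mk fun s hs h => ?_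
  rw [translateSum_apply hs, Finset.sum_eq_zero_iff] at h
  simpa using h 1 (Finset.mem_univ _)

theorem measurePreserving_mul_right_translateSum (k : K) :
    MeasurePreserving (· * (k : G)) (translateSum μ K) (translateSum μ K) := by
  refine ⟨measurable_mul_const _, Measure.ext fun s hs => ?_⟩
  have hm : Measurable (· * (k : G)) := measurable_mul_const _
  rw [Measure.map_apply hm hs, translateSum_apply (hm hs), translateSum_apply hs]
  refine Fintype.sum_equiv (Equiv.mulRight k) _ _ fun k' => congrArg μ ?_
  ext a
  simp [mul_assoc]

theorem measurePreserving_translateSum {T : G → G} (hT : MeasurePreserving T μ μ)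
    (hmul : ∀ a b, T (a * b) = T a * T b) (τ : Equiv.Perm K) (hτ : ∀ k : K, (τ k : G) = T k) :
    MeasurePreserving T (translateSum μ K) (translateSum μ K) := by
  refine ⟨hT.measurable, Measure.ext fun s hs => ?_⟩
  rw [Measure.map_apply hT.measurable hs, translateSum_apply (hT.measurable hs),
    translateSum_apply hs]
  refine Fintype.sum_equiv τ _ _ fun k => ?_
  rw [← hT.measure_preimage (measurable_mul_const _ hs).nullMeasurableSet]
  refine congrArg μ ?_
  ext a
  simp [hmul, hτ]

/-- Let `μ` be totally ergodic for an automorphism `T` preserving a finite subgroup `K`. The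
conditional measures of `μ` on the left cosets of `K` are then uniform on the cosets of a
`T`-invariant subgroup `S` of `K`; the extreme cases `S = ⊥` and `S = K` are made explicit. -/
theorem exists_invariant_subgroup_of_totally_ergodic [IsProbabilityMeasure μ] {T : G → G}
    (hTe : MeasurableEmbedding T) (hmul : ∀ a b, T (a * b) = T a * T b)
    (herg : ∀ n : ℕ, 1 ≤ n → Ergodic T^[n] μ) (hTK : ∀ k ∈ K, T k ∈ K) :
    ∃ S : Subgroup G, S ≤ K ∧ T '' (S : Set G) = S ∧
      (S = ⊥ → ∃ E, MeasurableSet E ∧ μ Eᶜ = 0 ∧ ∀ a ∈ E, ∀ k ∈ K, a * k ∈ E → k = 1) ∧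
      (S = K → ∀ k ∈ K, MeasurePreserving (· * k) μ μ) := by
  classical
  have hT : MeasurePreserving T μ μ := (herg 1 le_rfl).toMeasurePreserving
  obtain ⟨τ, hτ⟩ : ∃ τ : Equiv.Perm K, ∀ k : K, (τ k : G) = T k := by
    have hinj : Function.Injective fun k : K => (⟨T k, hTK k k.2⟩ : K) := fun a b hab =>
      Subtype.ext (hTe.injective (congrArg Subtype.val hab))
    exact ⟨Equiv.ofBijective _ hinj.bijective_of_finite, fun k => rfl⟩
  set ν := translateSum μ K with hν
  have hTν : MeasurePreserving T ν ν := measurePreserving_translateSum hT hmul τ hτ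
  have hRν : ∀ k : K, MeasurePreserving (· * (k : G)) ν ν :=
    measurePreserving_mul_right_translateSum
  have hac : μ ≪ ν := absolutelyContinuous_translateSum
  set f := μ.rnDeriv ν with hf
  have hfm : Measurable f := Measure.measurable_rnDeriv μ ν
  have hwd : ν.withDensity f = μ := Measure.withDensity_rnDeriv_eq _ _ hac
  -- `T` preserves both measures, hence the density.
  have hfT : ∀ᵐ a ∂ν, f (T a) = f a := by
    have := hTe.rnDeriv_map μ ν
    rwa [hT.map_eq, hTν.map_eq] at this
  have hfTn : ∀ n : ℕ, ∀ᵐ a ∂ν, f (T^[n] a) = f a := by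
    intro n
    induction n with
    | zero => simp
    | succ n ih =>
      filter_upwards [ih, (hTν.iterate n).quasiMeasurePreserving.ae hfT] with a h1 h2
      rw [Function.iterate_succ_apply', h2, h1]
  have hτn : ∀ (n : ℕ) (k : K), (((τ ^ n) k : K) : G) = T^[n] k := by
    intro n k
    induction n with
    | zero => rfl
    | succ n ih => rw [pow_succ', Equiv.Perm.mul_apply, hτ, ih, Function.iterate_succ_apply']
  have hmuln : ∀ (n : ℕ) (a b : G), T^[n] (a * b) = T^[n] a * T^[n] b := by
    intro n a b
    induction n with
    | zero => rfl
    | succ n ih => simp only [Function.iterate_succ_apply', ih, hmul]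
  -- The power `orderOf τ` of `T` fixes every `k`, so `a ↦ f (a * k)` is invariant under it; this is
  -- where total ergodicity enters.
  have hconst : ∀ k : K, ∃ c, ∀ᵐ a ∂μ, f (a * k) = c := by
    intro k
    refine (herg (orderOf τ) (orderOf_pos τ)).ae_eq_const_of_ae_eq_comp₀
      (g := fun a => f (a * (k : G)))
      (hfm.comp (measurable_mul_const _)).nullMeasurable ?_
    refine hac.ae_le ?_
    filter_upwards [(hRν k).quasiMeasurePreserving.ae (hfTn (orderOf τ))] with a ha
    rw [hmuln, ← hτn, pow_orderOf_eq_one] at ha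
    exact ha
  choose c hc using hconst
  have hgood : ∀ᵐ a ∂μ, ∀ k : K, f (a * k) = c k := ae_all_iff.2 hc
  -- A `μ`-a.e. property holds `ν`-a.e. where `f ≠ 0`, and in that form it can be moved along
  -- translations by `K`.
  have hgood' : ∀ᵐ a ∂μ, ∀ k : K, f (a * k) ≠ 0 → ∀ k' : K, f (a * k * k') = c k' := by
    refine hac.ae_le (ae_all_iff.2 fun k => ?_)
    have : ∀ᵐ a ∂ν, f a ≠ 0 → ∀ k : K, f (a * k) = c k := by
      rw [← hwd, ae_withDensity_iff hfm] at hgood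
      exact hgood
    exact (hRν k).quasiMeasurePreserving.ae this
  have hpos : ∀ᵐ a ∂μ, 0 < f a := Measure.rnDeriv_pos hac
  have hc1 : c 1 ≠ 0 := by
    obtain ⟨a, h1, h2⟩ := (hgood.and hpos).exists
    have := h1 1
    rw [OneMemClass.coe_one, mul_one] at this
    rw [← this]
    exact h2.ne'
  have hcmul : ∀ k k' : K, c k ≠ 0 → c (k * k') = c k' := by
    intro k k' hk
    obtain ⟨a, h1, h2⟩ := (hgood.and hgood').exists
    rw [← h1 (k * k'), ← h2 k (by rwa [h1 k]) k', Subgroup.coe_mul, mul_assoc]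
  have hcτ : ∀ k : K, c (τ k) = c k := by
    intro k
    obtain ⟨a, h1, h2, h3⟩ := (hgood.and ((hT.quasiMeasurePreserving.ae hgood).and
      (hac.ae_le ((hRν k).quasiMeasurePreserving.ae hfT)))).exists
    rw [← h1 k, ← h3, hmul, ← hτ, h2]
  let S : Subgroup G :=
    { carrier := {g | ∃ h : g ∈ K, c ⟨g, h⟩ ≠ 0}
      one_mem' := ⟨K.one_mem, hc1⟩
      mul_mem' := by
        rintro a b ⟨ha, ha'⟩ ⟨hb, hb'⟩
        refine ⟨K.mul_mem ha hb, ?_⟩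
        have := hcmul ⟨a, ha⟩ ⟨b, hb⟩ ha'
        exact this.trans_ne hb'
      inv_mem' := by
        rintro a ⟨ha, ha'⟩
        refine ⟨K.inv_mem ha, ?_⟩
        have := hcmul ⟨a, ha⟩ ⟨a, ha⟩⁻¹ ha'
        rw [mul_inv_cancel] at this
        exact this.symm.trans_ne hc1 }
  have hmemS : ∀ k : K, (k : G) ∈ S ↔ c k ≠ 0 := fun k => ⟨fun h => h.2, fun h => ⟨k.2, h⟩⟩
  have hSK : S ≤ K := fun g hg => hg.1
  refine ⟨S, hSK, ?_, ?_, ?_⟩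
  · ext g
    constructor
    · rintro ⟨s, hs, rfl⟩
      have := (hmemS ⟨s, hSK hs⟩).1 hs
      rw [← hcτ, ← hmemS, hτ] at this
      exact this
    · intro hg
      refine ⟨(τ.symm ⟨g, hSK hg⟩ : K), ?_, ?_⟩
      · have := (hmemS ⟨g, hSK hg⟩).1 hg
        rw [SetLike.mem_coe, hmemS, ← hcτ, Equiv.apply_symm_apply]
        exact this
      · rw [← hτ, Equiv.apply_symm_apply]
  · intro hS
    -- Within a coset, the density is positive at one point of this set and zero at all the others.
    refine ⟨{a | 0 < f a} ∩ ⋂ k : {k : K // k ≠ 1}, {a | f (a * (k : K)) = 0}, ?_, ?_, ?_⟩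
    · refine (measurableSet_lt measurable_const hfm).inter (MeasurableSet.iInter fun k => ?_)
      exact hfm.comp (measurable_mul_const _) (measurableSet_singleton 0)
    · refine mem_ae_iff.1 ?_
      filter_upwards [hpos, hgood] with a h1 h2
      refine ⟨h1, Set.mem_iInter.2 fun k => ?_⟩
      have h3 : ((k : K) : G) ∉ S := by
        rw [hS, Subgroup.mem_bot]
        exact fun h => k.2 (Subtype.ext h)
      rw [hmemS, not_not] at h3
      exact (h2 k).trans h3
    · intro a ha k hk hak
      by_contra hne
      have := Set.mem_iInter.1 ha.2 ⟨⟨k, hk⟩, fun h => hne (congrArg Subtype.val h)⟩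
      exact hak.1.ne' this
  · intro hS k hk
    have hcne : ∀ k : K, c k ≠ 0 := fun k => (hmemS k).1 (hS.ge k.2)
    have hcc : ∀ k : K, c k = c 1 := fun k => by
      have := hcmul k⁻¹ k (hcne _)
      rw [inv_mul_cancel] at this
      exact this.symm
    have hfc : f =ᵐ[ν] fun _ => c 1 := by
      have hms : MeasurableSet {a | ¬ f a = c 1} := (hfm (measurableSet_singleton (c 1))).compl
      refine ae_iff.2 ?_
      rw [hν, translateSum_apply hms]
      refine Finset.sum_eq_zero fun k _ => ae_iff.1 ?_
      filter_upwards [hgood] with a ha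
      rw [ha, hcc]
    have hμν : μ = c 1 • ν := by
      rw [← withDensity_const, ← withDensity_congr_ae hfc, hwd]
    refine ⟨measurable_mul_const _, ?_⟩
    rw [hμν, Measure.map_smul, (hRν ⟨k, hk⟩).map_eq]

end Cosets

/-! ### Measures invariant under translation by the kernel -/

section Uniform

variable {A : Type*}

theorem block_surjective [Nonempty A] (z : ℤ) (n : ℕ) :
    Function.Surjective (block z n : (ℤ → A) → _) := by
  intro u
  refine ⟨fun t => if h : (t - z).toNat < n then u ⟨(t - z).toNat, h⟩
    else Classical.arbitrary A, ?_⟩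
  funext i
  simp [block]

section Kernel

variable [Group (ℤ → A)] {Φ : (ℤ → A) →* (ℤ → A)} {ℓ r : ℕ} {φ : (Fin (ℓ + r + 1) → A) → A}

theorem HasLocalRule.eq_of_block_eq (h : HasLocalRule Φ ℓ r φ) (hL : LeftPermutative φ)
    (hR : RightPermutative φ) {a b : ℤ → A} {z : ℤ}
    (hab : block z (ℓ + r) a = block z (ℓ + r) b) (hΦ : Φ a = Φ b) : a = b := by
  rw [block_eq_iff] at hab
  push_cast at hab
  exact h.eq_of_image_eq hL hR (c := z + ℓ) (fun t h1 h2 => hab t (by omega) (by omega)) hΦ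

theorem HasLocalRule.exists_preimage_block [Finite A] [TopologicalSpace A] [DiscreteTopology A]
    (h : HasLocalRule Φ ℓ r φ) (hL : LeftPermutative φ) (hR : RightPermutative φ)
    (hc : Continuous Φ) (b w : ℤ → A) (z : ℤ) :
    ∃ a, block z (ℓ + r) a = block z (ℓ + r) w ∧ Φ a = b := by
  obtain ⟨a, h1, h2⟩ := h.exists_preimage hL hR hc b w (z + ℓ)
  refine ⟨a, block_eq_iff.2 fun t h3 h4 => h1 t (by omega) ?_, h2⟩
  push_cast at h4
  omega

theorem HasLocalRule.finite_ker [Finite A] (h : HasLocalRule Φ ℓ r φ) (hL : LeftPermutative φ)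
    (hR : RightPermutative φ) : Finite Φ.ker :=
  Finite.of_injective (fun k : Φ.ker => block 0 (ℓ + r) (k : ℤ → A)) fun a b hab =>
    Subtype.ext (h.eq_of_block_eq hL hR hab (a.2.trans b.2.symm))

/-- The kernel is the fibre over `1`, and a fibre is parametrized by the blocks of length `ℓ + r`.
-/
theorem HasLocalRule.card_ker [Fintype A] [Nonempty A] [TopologicalSpace A] [DiscreteTopology A]
    [Fintype Φ.ker] (h : HasLocalRule Φ ℓ r φ) (hL : LeftPermutative φ) (hR : RightPermutative φ)
    (hc : Continuous Φ) : Fintype.card Φ.ker = Fintype.card A ^ (ℓ + r) := by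
  have hbij : Function.Bijective fun k : Φ.ker => block 0 (ℓ + r) (k : ℤ → A) := by
    refine ⟨fun a b hab => Subtype.ext (h.eq_of_block_eq hL hR hab (a.2.trans b.2.symm)),
      fun u => ?_⟩
    obtain ⟨w, rfl⟩ := block_surjective 0 (ℓ + r) u
    obtain ⟨a, h1, h2⟩ := h.exists_preimage_block hL hR hc 1 w 0
    exact ⟨⟨a, h2⟩, h1⟩
  rw [Fintype.card_of_bijective hbij, Fintype.card_fun, Fintype.card_fin]

variable [Fintype A] [Nonempty A] [TopologicalSpace A] [DiscreteTopology A] [MeasurableSpace A]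
  [BorelSpace A] [MeasurableSingletonClass A] {μ : Measure (ℤ → A)}

/-- If `μ` is invariant under translation by `ker Φ`, then a block of length `ℓ + r` is uniform
and independent of the image under `Φ`. -/
theorem measure_block_inter_preimage (h : HasLocalRule Φ ℓ r φ) (hL : LeftPermutative φ)
    (hR : RightPermutative φ) (hc : Continuous Φ)
    (hK : ∀ k ∈ Φ.ker, MeasurePreserving (· * k) μ μ) (z : ℤ) (w : ℤ → A) {B : Set (ℤ → A)}
    (hB : MeasurableSet B) :
    μ (block z (ℓ + r) ⁻¹' {block z (ℓ + r) w} ∩ Φ ⁻¹' B) =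
      ((Fintype.card A : ENNReal) ^ (ℓ + r))⁻¹ * μ (Φ ⁻¹' B) := by
  classical
  have := h.finite_ker hL hR
  have := Fintype.ofFinite Φ.ker
  set W : Set (ℤ → A) := block z (ℓ + r) ⁻¹' {block z (ℓ + r) w} ∩ Φ ⁻¹' B with hW
  have hWm : MeasurableSet W := (measurableSet_block _ _ _).inter (hc.measurable hB)
  have hΦk : ∀ (a : ℤ → A) (k : Φ.ker), Φ (a * k) = Φ a := fun a k => by
    rw [map_mul, k.2, mul_one]
  -- Each coset of the kernel has exactly one point with the prescribed block, so these translates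
  -- of `W`, all of equal measure, tile `Φ ⁻¹' B`.
  have hU : Φ ⁻¹' B = ⋃ k : Φ.ker, (· * (k : ℤ → A)) ⁻¹' W := by
    ext a
    simp only [hW, Set.mem_iUnion, Set.mem_preimage, Set.mem_inter_iff, Set.mem_singleton_iff, hΦk]
    constructor
    · intro ha
      obtain ⟨b, h1, h2⟩ := h.exists_preimage_block hL hR hc (Φ a) w z
      refine ⟨⟨a⁻¹ * b, ?_⟩, ?_, ha⟩
      · rw [MonoidHom.mem_ker, map_mul, h2, map_inv, inv_mul_cancel]
      · simpa using h1
    · rintro ⟨k, _, ha⟩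
      exact ha
  have hdisj : Pairwise (Function.onFun Disjoint fun k : Φ.ker => (· * (k : ℤ → A)) ⁻¹' W) := by
    intro k k' hkk
    refine Set.disjoint_left.2 fun a h1 h2 => hkk ?_
    have h3 : block z (ℓ + r) (a * (k : ℤ → A)) = block z (ℓ + r) (a * (k' : ℤ → A)) :=
      h1.1.trans h2.1.symm
    exact Subtype.ext (mul_left_cancel
      (h.eq_of_block_eq hL hR h3 ((hΦk a k).trans (hΦk a k').symm)))
  have hsum : μ (Φ ⁻¹' B) = (Fintype.card A : ENNReal) ^ (ℓ + r) * μ W := by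
    rw [hU, measure_iUnion hdisj fun k => (hK k k.2).measurable hWm, tsum_fintype]
    simp only [fun k : Φ.ker => (hK k k.2).measure_preimage hWm.nullMeasurableSet]
    rw [Finset.sum_const, Finset.card_univ, h.card_ker hL hR hc, nsmul_eq_mul]
    push_cast
    rfl
  rw [hsum, ← mul_assoc, ENNReal.inv_mul_cancel, one_mul]
  · exact pow_ne_zero _ (by exact_mod_cast Fintype.card_ne_zero)
  · exact ENNReal.pow_ne_top (ENNReal.natCast_ne_top _)

/-- A block of length `(j + 1) * (ℓ + r)` carries the same information as its first `ℓ + r` cells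
with a block of length `j * (ℓ + r)` of the image; these are independent, and the image again has
law `μ`. -/
theorem measure_block_eq [IsProbabilityMeasure μ] (h : HasLocalRule Φ ℓ r φ)
    (hL : LeftPermutative φ) (hR : RightPermutative φ) (hc : Continuous Φ)
    (hΦ : MeasurePreserving Φ μ μ) (hK : ∀ k ∈ Φ.ker, MeasurePreserving (· * k) μ μ)
    (j : ℕ) (z : ℤ) (x : ℤ → A) :
    μ (block z (j * (ℓ + r)) ⁻¹' {block z (j * (ℓ + r)) x}) =
      ((Fintype.card A : ENNReal) ^ (j * (ℓ + r)))⁻¹ := by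
  induction j generalizing z x with
  | zero =>
    have : block z (0 * (ℓ + r)) ⁻¹' {block z (0 * (ℓ + r)) x} = Set.univ := by
      ext a
      simp only [Set.mem_preimage, Set.mem_singleton_iff, Set.mem_univ, iff_true]
      exact block_eq_iff.2 fun t h1 h2 => by push_cast at h2; omega
    rw [this]
    simp
  | succ j ih =>
    have hset : block z ((j + 1) * (ℓ + r)) ⁻¹' {block z ((j + 1) * (ℓ + r)) x} =
        block z (ℓ + r) ⁻¹' {block z (ℓ + r) x} ∩
          Φ ⁻¹' (block (z + ℓ) (j * (ℓ + r)) ⁻¹' {block (z + ℓ) (j * (ℓ + r)) (Φ x)}) := by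
      ext a
      simp only [Set.mem_preimage, Set.mem_singleton_iff, Set.mem_inter_iff, block_eq_iff]
      have hj : (((j + 1) * (ℓ + r) : ℕ) : ℤ) = (j * (ℓ + r) : ℕ) + ℓ + r := by
        push_cast; ring
      rw [hj]
      have hj0 : (0 : ℤ) ≤ (j * (ℓ + r) : ℕ) := Int.natCast_nonneg _
      generalize ((j * (ℓ + r) : ℕ) : ℤ) = m at hj0
      push_cast
      constructor
      · exact fun ha => ⟨fun t h1 h2 => ha t h1 (by omega), fun t h1 h2 =>
          h.apply_eq fun t' h3 h4 => ha t' (by omega) (by omega)⟩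
      · rintro ⟨h1, h2⟩ t h3 h4
        exact h.eq_of_eq hL hR (c := z + ℓ) (p := z + ℓ) (q := z + ℓ + m) le_rfl (by omega)
          (fun t h5 h6 => h1 t (by omega) (by omega)) h2 t (by omega) (by omega)
    have hm := measurableSet_block (z + ℓ) (j * (ℓ + r)) (block (z + ℓ) (j * (ℓ + r)) (Φ x))
    rw [hset, measure_block_inter_preimage h hL hR hc hK z x hm,
      hΦ.measure_preimage hm.nullMeasurableSet, ih, Nat.succ_mul,
      pow_add _ (j * (ℓ + r)),
      ENNReal.mul_inv (Or.inr (ENNReal.pow_ne_top (ENNReal.natCast_ne_top _)))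
        (Or.inl (ENNReal.pow_ne_top (ENNReal.natCast_ne_top _))), mul_comm]

end Kernel

variable [Fintype A] [Nonempty A] [MeasurableSpace A] [MeasurableSingletonClass A]

instance : IsProbabilityMeasure (ProbabilityTheory.uniformOn (Set.univ : Set A)) :=
  ProbabilityTheory.isProbabilityMeasure_uniformOn Set.finite_univ Set.univ_nonempty

theorem uniformBernoulli_block (z : ℤ) (n : ℕ) (x : ℤ → A) :
    uniformBernoulli A (block z n ⁻¹' {block z n x}) = ((Fintype.card A : ENNReal) ^ n)⁻¹ := by
  have hset : block z n ⁻¹' {block z n x} =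
      Set.pi (Finset.Ico z (z + n) : Finset ℤ) fun i => {x i} := by
    ext a
    simp [block_eq_iff]
  rw [hset, uniformBernoulli, Measure.infinitePi_pi _ fun i _ => measurableSet_singleton _]
  simp [ProbabilityTheory.uniformOn_univ, ENNReal.inv_pow]

/-- A measure giving the uniform weights to a cofinal family of blocks is uniform Bernoulli. -/
theorem eq_uniformBernoulli {μ : Measure (ℤ → A)} [IsProbabilityMeasure μ] {s : ℕ} (hs : 0 < s)
    (hμ : ∀ (j : ℕ) (z : ℤ) (x : ℤ → A),
      μ (block z (j * s) ⁻¹' {block z (j * s) x}) = ((Fintype.card A : ENNReal) ^ (j * s))⁻¹) :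
    μ = uniformBernoulli A := by
  refine Measure.eq_infinitePi _ fun F t ht => ?_
  rw [← Measure.infinitePi_pi (μ := fun _ : ℤ => ProbabilityTheory.uniformOn (Set.univ : Set A))
    fun i _ => ht i]
  change μ _ = uniformBernoulli A _
  obtain ⟨m, hm⟩ : ∃ m : ℕ, ∀ i ∈ F, i.natAbs < m :=
    ⟨F.sup Int.natAbs + 1, fun i hi => Nat.lt_succ_of_le (Finset.le_sup (f := Int.natAbs) hi)⟩
  -- A multiple of `s` that is at least `2 * m`, so the block starting at `-m` covers `F`.
  set n := 2 * m * s with hn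
  have hns : 2 * m ≤ n := Nat.le_mul_of_pos_right _ hs
  have hset : Set.pi (F : Set ℤ) t = ⋃ u ∈ {u : Fin n → A | ∃ a ∈ Set.pi (F : Set ℤ) t,
      block (-m) n a = u}, block (-m) n ⁻¹' {u} := by
    ext a
    simp only [Set.mem_iUnion, Set.mem_preimage, Set.mem_singleton_iff, exists_prop]
    constructor
    · exact fun ha => ⟨_, ⟨a, ha, rfl⟩, rfl⟩
    · rintro ⟨u, ⟨b, hb, rfl⟩, hab⟩ i hi
      rw [block_eq_iff.1 hab i (by have := hm i hi; omega) (by have := hm i hi; omega)]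
      exact hb i hi
  have hd : Set.PairwiseDisjoint {u : Fin n → A | ∃ a ∈ Set.pi (F : Set ℤ) t,
      block (-m) n a = u} fun u => (block (-m) n : (ℤ → A) → _) ⁻¹' {u} := by
    intro u _ v _ huv
    refine Set.disjoint_left.2 fun a h1 h2 => huv (Eq.trans (Eq.symm h1) h2)
  rw [hset, measure_biUnion (Set.to_countable _) hd fun u _ => measurableSet_block _ _ _,
    measure_biUnion (Set.to_countable _) hd fun u _ => measurableSet_block _ _ _]
  refine tsum_congr fun u => ?_
  obtain ⟨x, hx⟩ := block_surjective (-m) n (u : Fin n → A)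
  rw [← hx, uniformBernoulli_block, hμ]

end Uniform

end

end BipermutativeCA

/-! ### The main theorem: the dichotomy for the invariant subgroup of the kernel -/

open MeasureTheory BipermutativeCA in
theorem mainTheorem3 {A : Type*} [Finite A] [Nonempty A]
    [TopologicalSpace A] [DiscreteTopology A]
    [MeasurableSpace A] [MeasurableSingletonClass A]
    [Group (ℤ → A)] (hA : IsGroupShift A)
    (Φ : (ℤ → A) →* (ℤ → A)) (hCA : IsCellularAutomaton Φ) (hbi : IsBipermutative Φ)
    (hker : ∀ J : Subgroup (ℤ → A), J ≤ Φ.ker →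
      shift '' (J : Set (ℤ → A)) = (J : Set (ℤ → A)) → J = ⊥ ∨ J = Φ.ker)
    (μ : Measure (ℤ → A)) [IsProbabilityMeasure μ]
    (hinv : MeasurePreserving Φ μ μ) (herg : TotallyShiftErgodic μ)
    (hent : 0 < entropy μ Φ) :
    μ = uniformBernoulli A := by
  obtain ⟨_⟩ := nonempty_fintype A
  have : BorelSpace A := ⟨by
    rw [borel_eq_top_of_discrete]
    exact eq_top_iff.2 fun s _ => MeasurableSet.of_discrete⟩
  have := hA.isTopologicalGroup
  obtain ⟨ℓ, r, φ, h, hL, hR⟩ := hbi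
  have hc := hCA.continuous
  have := h.finite_ker hL hR
  have := Fintype.ofFinite Φ.ker
  have hσ : MeasurePreserving shift μ μ := (herg 1 le_rfl).toMeasurePreserving
  have hσe : MeasurableEmbedding (shift : (ℤ → A) → (ℤ → A)) := by
    refine MeasurableEmbedding.of_measurable_inverse (g := fun a z => a (z + 1)) measurable_shift
      ?_ (measurable_pi_lambda _ fun z => measurable_pi_apply (z + 1)) fun a => ?_
    · rw [Set.range_eq_univ.2 fun a => ⟨fun z => a (z + 1), ?_⟩]
      · exact MeasurableSet.univ
      · funext z
        simp [shift]
    · funext z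
      simp [shift]
  have hσK : ∀ k ∈ Φ.ker, shift k ∈ Φ.ker := by
    intro k hk
    rw [MonoidHom.mem_ker] at hk ⊢
    rw [hCA.comm_shift, hk]
    exact map_one (MonoidHom.mk' shift hA.shift_mul)
  obtain ⟨S, hSK, hσS, hbot, htop⟩ :=
    exists_invariant_subgroup_of_totally_ergodic hσe hA.shift_mul herg hσK
  -- Positive entropy excludes the almost everywhere injective case.
  have hne : S ≠ ⊥ := by
    intro hS
    obtain ⟨E, hE, hE0, hE1⟩ := hbot hS
    refine hent.ne' (entropy_eq_zero_of_injOn h hL hR hc hσ hinv hE hE0 fun a ha b hb hab => ?_)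
    have := hE1 a ha (a⁻¹ * b) (by rw [MonoidHom.mem_ker, map_mul, map_inv, hab, inv_mul_cancel])
      (by rwa [mul_inv_cancel_left])
    exact (inv_mul_eq_one.1 this)
  have hS : S = Φ.ker := (hker S hSK hσS).resolve_left hne
  -- If `ℓ + r = 0`, the determining block is empty, so `Φ` is injective and its kernel trivial,
  -- contradicting `hne`.
  refine eq_uniformBernoulli (s := ℓ + r) (Nat.pos_of_ne_zero fun h0 => hne ?_)
    (measure_block_eq h hL hR hc hinv (htop hS))
  refine (Subgroup.eq_bot_iff_forall S).2 fun k hk => ?_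
  refine h.eq_of_block_eq hL hR (z := 0) (block_eq_iff.2 fun t h1 h2 => ?_)
    ((hSK hk).trans (map_one Φ).symm)
  rw [h0] at h2
  simp at h2
  omega
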